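/- Let $K$ be a field of characteristic $0$. For homogeneous elements $a_1,\dots,a_n$ of a $\mathbb Z$-graded $K$-vector space and $\sigma\in S_n$, let $\epsilon(\sigma)=\epsilon(\sigma;a_1,\dots,a_n)$ be the Koszul sign, defined by $a_1\wedge\cdots\wedge a_n=\epsilon(\sigma)\,a_{\sigma(1)}\wedge\cdots\wedge a_{\sigma(n)}$ in the free graded commutative algebra, and let $\chi(\sigma)=\operatorname{sgn}(\sigma)\,\epsilon(\sigma)$. An $HA_\infty$-algebra $(A,\mu_k,\alpha)$ is a graded vector space $A=\bigoplus_{i\in\mathbb Z}A_i$ with multilinear maps $\mu_k:A^{\otimes k}\to A$ of degree $k-2$ ($k\ge1$) and a linear map $\alpha:A\to A$ of degree $0$ such that $\alpha(\mu_k(a_1,\dots,a_k))=\mu_k(\alpha(a_1),\dots,\alpha(a_k))$ and, for all $n\ge1$ and all homogeneous $a_1,\dots,a_n$, $$\sum_{\substack{i+j=n+1\\ i,j\ge1}}\ \sum_{\lambda=1}^{j}(-1)^{\lambda(i+1)+i(|a_1|+\cdots+|a_{\lambda-1}|)}\,\mu_j\big(\alpha^{i-1}a_1,\dots,\alpha^{i-1}a_{\lambda-1},\mu_i(a_\lambda,\dots,a_{\lambda+i-1}),\alpha^{i-1}a_{\lambda+i},\dots,\alpha^{i-1}a_n\big)=0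 .$$ An $HL_\infty$-algebra $(L,l_k,\alpha)$ is a graded vector space $L=\bigoplus_{i\in\mathbb Z}L_i$ with multilinear maps $l_k:L^{\otimes k}\to L$ of degree $k-2$ ($k\ge1$) that are skew-symmetric, i.e. $l_k(a_{\sigma(1)},\dots,a_{\sigma(k)})=\chi(\sigma)\,l_k(a_1,\dots,a_k)$ for homogeneous $a_1,\dots,a_k$ and $\sigma\in S_k$, and a linear map $\alpha:L\to L$ of degree $0$ such that $\alpha(l_k(a_1,\dots,a_k))=l_k(\alpha(a_1),\dots,\alpha(a_k))$ and, for all $n\ge1$ and all homogeneous $a_1,\dots,a_n$, $$\sum_{\substack{i+j=n+1\\ i,j\ge1}}\ \sum_{\sigma}\chi(\sigma)\,(-1)^{i(j-1)}\,l_j\big(l_i(a_{\sigma(1)},\dots,a_{\sigma(i)}),\alpha^{i-1}a_{\sigma(i+1)},\dots,\alpha^{i-1}a_{\sigma(n)}\big)=0,$$ where $\sigma$ runs over the $(i,n-i)$-unshuffles, i.e. $\sigma(1)<\cdots<\sigma(i)$ and $\sigma(i+1)<\cdots<\sigma(n)$. **Theorem.** Let $(A,\mu_k,\alpha)$ be an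 $HA_\infty$-algebra. Let $l_k:A^{\otimes k}\to A$ ($k\ge1$) be the multilinear maps given on homogeneous elements by $$l_k(a_1,\dots,a_k)=(-1)^{\frac{(k-1)(k-2)}2}\sum_{\sigma\in S_k}\chi(\sigma)\,\mu_k(a_{\sigma(1)},\dots,a_{\sigma(k)}).$$ Then $(A,l_k,\alpha)$ is an $HL_\infty$-algebra. Moreover $l_1=\mu_1$, $l_2(a,b)=\mu_2(a,b)-(-1)^{|a||b|}\mu_2(b,a)$ for homogeneous $a,b$, and $l_k=0$ whenever $\mu_k=0$; so if $\mu_k=0$ for all $k\ge3$ (the case of a differential graded hom-associative algebra), one recovers the graded commutator with the differential $l_1=\mu_1$. -/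

import Mathlib

open scoped BigOperators

noncomputable section

namespace HomAlg

/-- Koszul sign `ε(σ; a₀, …, aₙ₋₁)` for homogeneous `aₘ` of degree `d m`, that is
`a₀ ∧ ⋯ ∧ aₙ₋₁ = ε(σ) a_{σ 0} ∧ ⋯ ∧ a_{σ (n-1)}` in the free graded commutative algebra:
each inversion of `σ` contributes `(-1) ^ (product of the two degrees)`. -/
def koszulSign {n : ℕ} (d : Fin n → ℤ) (σ : Equiv.Perm (Fin n)) : ℤˣ :=
  ∏ p : Fin n, ∏ q : Fin n,
    if p < q ∧ σ q < σ p then Int.negOnePow (d (σ p) * d (σ q)) else 1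

/-- `χ(σ; a) = (-1)^σ ε(σ; a)`. -/
def chi {n : ℕ} (d : Fin n → ℤ) (σ : Equiv.Perm (Fin n)) : ℤˣ :=
  Equiv.Perm.sign σ * koszulSign d σ

/-- `σ` is an `(i, n - i)`-unshuffle:
`σ 0 < ⋯ < σ (i-1)` and `σ i < ⋯ < σ (n-1)`. -/
def IsUnshuffle {n : ℕ} (i : ℕ) (σ : Equiv.Perm (Fin n)) : Prop :=
  ∀ p q : Fin n, p < q → ((q : ℕ) < i ∨ i ≤ (p : ℕ)) → σ p < σ q

section Structures

variable {K V : Type*} [Field K] [AddCommGroup V] [Module K V]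

/-- The left-hand side of the `n`-th `HA∞`-relation on homogeneous `a₀, …, aₙ₋₁` of degrees `d`.
The inner operation has arity `i = s + 1`, the outer one has arity `j = n - s = n + 1 - i`,
and `λ = r + 1` is the (one-based) position of the inner operation, so that the sign is
`(-1)^(λ (i + 1) + i (|a₁| + ⋯ + |a_{λ-1}|))` and the remaining arguments carry `α^(i-1) = α^s`. -/
def haRelation (μ : ∀ k : ℕ, MultilinearMap K (fun _ : Fin k => V) V) (α : V →ₗ[K] V)
    {n : ℕ} (d : Fin n → ℤ) (a : Fin n → V) : V :=
  ∑ s : Fin n, ∑ r : Fin (n - s),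
    Int.negOnePow (((r : ℤ) + 1) * (((s : ℤ) + 1) + 1)
        + ((s : ℤ) + 1) * ∑ m : Fin n, if (m : ℕ) < r then d m else 0) •
      μ (n - s) (fun p : Fin (n - s) =>
        if (p : ℕ) < r then (α ^ (s : ℕ)) (a ⟨p, by omega⟩)
        else if (p : ℕ) = r then
          μ (s + 1) (fun q : Fin (s + 1) => a ⟨r + q, by omega⟩)
        else (α ^ (s : ℕ)) (a ⟨p + s, by omega⟩))

open Classical in
/-- The left-hand side of the `n`-th `HL∞`-relation on homogeneous `a₀, …, aₙ₋₁` of degrees `d`.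
The inner operation has arity `i = s + 1`, the outer one has arity `j = n - s = n + 1 - i`, so
that the sign is `χ(σ) (-1)^(i (j - 1))`; `σ` runs over the `(i, n - i)`-unshuffles. -/
def hlRelation (l : ∀ k : ℕ, MultilinearMap K (fun _ : Fin k => V) V) (α : V →ₗ[K] V)
    {n : ℕ} (d : Fin n → ℤ) (a : Fin n → V) : V :=
  ∑ s : Fin n, ∑ σ : Equiv.Perm (Fin n) with IsUnshuffle (s + 1) σ,
    (chi d σ * Int.negOnePow (((s : ℤ) + 1) * (((n : ℤ) - (s : ℤ)) - 1))) •
      l (n - s) (fun p : Fin (n - s) =>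
        if (p : ℕ) = 0 then
          l (s + 1) (fun q : Fin (s + 1) => a (σ ⟨q, by omega⟩))
        else (α ^ (s : ℕ)) (a (σ ⟨p + s, by omega⟩)))

/-- `(V, μ_k, α)` is an `HA∞`-algebra, where `V = ⨁ 𝒜 i` is a graded vector space. Only the
operations `μ k` with `k ≥ 1` are part of the structure; `μ 0` plays no role. -/
structure IsHAInfinity (𝒜 : ℤ → Submodule K V)
    (μ : ∀ k : ℕ, MultilinearMap K (fun _ : Fin k => V) V) (α : V →ₗ[K] V) : Prop where
  degree_op : ∀ k : ℕ, 1 ≤ k → ∀ (d : Fin k → ℤ) (a : Fin k → V), (∀ m, a m ∈ 𝒜 (d m)) →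
    μ k a ∈ 𝒜 ((∑ m, d m) + ((k : ℤ) - 2))
  degree_map : ∀ (i : ℤ) (x : V), x ∈ 𝒜 i → α x ∈ 𝒜 i
  map_op : ∀ k : ℕ, 1 ≤ k → ∀ a : Fin k → V, α (μ k a) = μ k (fun m => α (a m))
  relation : ∀ n : ℕ, 1 ≤ n → ∀ (d : Fin n → ℤ) (a : Fin n → V), (∀ m, a m ∈ 𝒜 (d m)) →
    haRelation μ α d a = 0

/-- `(V, l_k, α)` is an `HL∞`-algebra, where `V = ⨁ 𝒜 i` is a graded vector space. Only the
operations `l k` with `k ≥ 1` are part of the structure; `l 0` plays no role. -/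
structure IsHLInfinity (𝒜 : ℤ → Submodule K V)
    (l : ∀ k : ℕ, MultilinearMap K (fun _ : Fin k => V) V) (α : V →ₗ[K] V) : Prop where
  degree_op : ∀ k : ℕ, 1 ≤ k → ∀ (d : Fin k → ℤ) (a : Fin k → V), (∀ m, a m ∈ 𝒜 (d m)) →
    l k a ∈ 𝒜 ((∑ m, d m) + ((k : ℤ) - 2))
  skew_symm : ∀ k : ℕ, 1 ≤ k → ∀ (d : Fin k → ℤ) (a : Fin k → V), (∀ m, a m ∈ 𝒜 (d m)) →
    ∀ σ : Equiv.Perm (Fin k), l k (fun m => a (σ m)) = chi d σ • l k a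
  degree_map : ∀ (i : ℤ) (x : V), x ∈ 𝒜 i → α x ∈ 𝒜 i
  map_op : ∀ k : ℕ, 1 ≤ k → ∀ a : Fin k → V, α (l k a) = l k (fun m => α (a m))
  relation : ∀ n : ℕ, 1 ≤ n → ∀ (d : Fin n → ℤ) (a : Fin n → V), (∀ m, a m ∈ 𝒜 (d m)) →
    hlRelation l α d a = 0

/-- The projection of `V = ⨁ 𝒜 i` onto the sum of the `𝒜 i` with `i ≡ e` modulo `2`. -/
def parityProj (𝒜 : ℤ → Submodule K V) [DirectSum.Decomposition 𝒜] (e : Fin 2) : V →ₗ[K] V :=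
  (DirectSum.toModule K ℤ V
    (fun i => if i % 2 = ((e : ℕ) : ℤ) then (𝒜 i).subtype else 0)) ∘ₗ
    (DirectSum.decomposeLinearEquiv 𝒜).toLinearMap

/-- The multilinear maps with
`(a₁, …, a_k) ↦ ∑ σ, χ(σ) μ_k (a_{σ 1}, …, a_{σ k})` on homogeneous elements
(see `skewSymmetrization_apply`). The sign `χ(σ)` depends only on the parities of the degrees,
so the multilinear extension is obtained by splitting each argument into its even and odd part. -/
def skewSymmetrization (𝒜 : ℤ → Submodule K V) [DirectSum.Decomposition 𝒜]
    (μ : ∀ k : ℕ, MultilinearMap K (fun _ : Fin k => V) V) (k : ℕ) :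
    MultilinearMap K (fun _ : Fin k => V) V :=
  ∑ e : Fin k → Fin 2, ∑ σ : Equiv.Perm (Fin k),
    ((chi (fun m => ((e m : ℕ) : ℤ)) σ : ℤˣ) : ℤ) •
      ((μ k).domDomCongr σ).compLinearMap (fun m => parityProj 𝒜 (e m))

theorem parityProj_apply (𝒜 : ℤ → Submodule K V) [DirectSum.Decomposition 𝒜] (e : Fin 2)
    {i : ℤ} {x : V} (hx : x ∈ 𝒜 i) :
    parityProj 𝒜 e x = if i % 2 = ((e : ℕ) : ℤ) then x else 0 := by
  lift x to 𝒜 i using hx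
  simp only [parityProj, LinearMap.comp_apply, LinearEquiv.coe_coe,
    DirectSum.decomposeLinearEquiv_apply, DirectSum.decompose_coe]
  rw [← DirectSum.lof_eq_of K, DirectSum.toModule_lof]
  split_ifs <;> simp

theorem chi_congr {n : ℕ} {d d' : Fin n → ℤ} (h : ∀ m, d m % 2 = d' m % 2)
    (σ : Equiv.Perm (Fin n)) : chi d σ = chi d' σ := by
  unfold chi koszulSign
  congr 1
  refine Finset.prod_congr rfl fun p _ => Finset.prod_congr rfl fun q _ => ?_
  congr 1
  have key : d (σ p) * d (σ q) ≡ d' (σ p) * d' (σ q) [ZMOD 2] :=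
    Int.ModEq.mul (h (σ p)) (h (σ q))
  rw [Int.negOnePow_eq_iff]
  exact even_iff_two_dvd.mpr key.symm.dvd

/-- The defining formula of the skew-symmetrization on homogeneous elements. -/
theorem skewSymmetrization_apply (𝒜 : ℤ → Submodule K V) [DirectSum.Decomposition 𝒜]
    (μ : ∀ k : ℕ, MultilinearMap K (fun _ : Fin k => V) V) (k : ℕ)
    (d : Fin k → ℤ) (a : Fin k → V) (ha : ∀ m, a m ∈ 𝒜 (d m)) :
    skewSymmetrization 𝒜 μ k a =
      ∑ σ : Equiv.Perm (Fin k), chi d σ • μ k (fun m => a (σ m)) := by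
  have hlt : ∀ m, (d m % 2).toNat < 2 := fun m => by omega
  let e₀ : Fin k → Fin 2 := fun m => ⟨(d m % 2).toNat, hlt m⟩
  have he₀ : ∀ m, ((e₀ m : ℕ) : ℤ) = d m % 2 := fun m => by
    simp only [e₀]; omega
  simp only [skewSymmetrization, sum_apply, smul_apply,
    MultilinearMap.compLinearMap_apply, MultilinearMap.domDomCongr_apply]
  rw [Finset.sum_eq_single e₀]
  · refine Finset.sum_congr rfl fun σ _ => ?_
    rw [chi_congr (d := fun m => ((e₀ m : ℕ) : ℤ)) (d' := d) (fun m => by rw [he₀]; omega) σ]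
    rw [Units.smul_def]
    congr 2
    funext m
    rw [parityProj_apply 𝒜 _ (ha _), if_pos (he₀ _).symm]
  · intro e _ hne
    obtain ⟨m, hm⟩ := Function.ne_iff.mp hne
    refine Finset.sum_eq_zero fun σ _ => ?_
    have : (μ k) (fun i => parityProj 𝒜 (e (σ i)) (a (σ i))) = 0 := by
      refine MultilinearMap.map_coord_zero _ (σ.symm m) ?_
      rw [Equiv.apply_symm_apply, parityProj_apply 𝒜 _ (ha _), if_neg]
      intro h
      exact hm (Fin.ext (by have := he₀ m; omega))
    rw [this, smul_zero]
  · simp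

/-- The brackets `l_k = (-1)^((k-1)(k-2)/2) ∑ σ, χ(σ) μ_k (a_{σ 1}, …, a_{σ k})`, so that the
sign prefactor is `+, +, -, -, +, +, …` for `k = 1, 2, 3, 4, 5, 6, …`. -/
def bracket (𝒜 : ℤ → Submodule K V) [DirectSum.Decomposition 𝒜]
    (μ : ∀ k : ℕ, MultilinearMap K (fun _ : Fin k => V) V) (k : ℕ) :
    MultilinearMap K (fun _ : Fin k => V) V :=
  ((-1 : ℤ) ^ ((k - 1) * (k - 2) / 2)) • skewSymmetrization 𝒜 μ k

end Structures

end HomAlg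

end

namespace HomAlg

/-! The `HL∞`-relation of the brackets is, up to a global sign, the skew-symmetrization of the
`HA∞`-relation (`IsHAInfinity.hlRelation_bracket_eq`), so it vanishes term by term.

Expanding both brackets in a summand of inner arity `s + 1` and outer arity `k` gives a sum over an
unshuffle `σ` and permutations `τ`, `ρ` of the outer and inner arguments. Put `r = τ⁻¹ 0`, the slot
of the inner operation, and let `π` be the resulting order of all `n` arguments. Then `(σ, τ, ρ) ↦
(r, π)` is a bijection (`sum_isUnshuffle`), and `(r, π)` indexes exactly the summands of the
`HA∞`-relation on permuted arguments.

For the signs, `χ` is a cocycle (`chi_mul`), and `chi_blockPerm` compares moving a block of `s + 1`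
arguments with moving the single output of the inner operation; the discrepancy is the `HA∞` sign up
to `(-1)^s`. The prefactors of the brackets absorb the rest (`bracketSign_mul`), leaving a sign that
depends only on `n`. -/

/-! ### The sign `χ` as a product over inversions; cocycle property -/

theorem prod_prod_eq_of_symm {ι M : Type*} [Fintype ι] [LinearOrder ι] [CommMonoid M]
    (F : ι → ι → M) :
    ∏ p, ∏ q, F p q =
      (∏ p, F p p) * ∏ p, ∏ q, if p < q then F p q * F q p else 1 := by
  have h1 : ∀ p q, F p q = (if p = q then F p q else 1) *
      ((if p < q then F p q else 1) * (if q < p then F p q else 1)) := by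
    intro p q
    rcases lt_trichotomy p q with h | h | h
    · simp [h, h.ne, h.not_gt]
    · simp [h]
    · simp [h, h.ne', h.not_gt]
  have h2 : ∀ p q, (if p < q then F p q * F q p else 1) =
      (if p < q then F p q else 1) * (if p < q then F q p else 1) := by
    intro p q
    split_ifs <;> simp
  simp_rw [h2, Finset.prod_mul_distrib]
  conv_lhs => enter [2, p, 2, q]; rw [h1 p q]
  simp_rw [Finset.prod_mul_distrib]
  congr 1
  · simp
  · congr 1
    exact Finset.prod_comm

/-- Comparing unordered pairs suffices. This is needed because reindexing an inversion product by a
permutation does not preserve `p < q`. -/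
theorem prod_prod_congr_of_symm {ι M : Type*} [Fintype ι] [LinearOrder ι] [CommMonoid M]
    {F G : ι → ι → M} (hd : ∀ p, F p p = G p p)
    (h : ∀ p q, p < q → F p q * F q p = G p q * G q p) :
    ∏ p, ∏ q, F p q = ∏ p, ∏ q, G p q := by
  rw [prod_prod_eq_of_symm F, prod_prod_eq_of_symm G]
  congr 1
  · exact Finset.prod_congr rfl fun p _ => hd p
  · refine Finset.prod_congr rfl fun p _ => Finset.prod_congr rfl fun q _ => ?_
    split_ifs with hpq
    · exact h p q hpq
    · rfl

/-- The sign for exchanging two adjacent arguments of degrees `x` and `y` of a graded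
skew-symmetric map. -/
def swapSign (x y : ℤ) : ℤˣ := -Int.negOnePow (x * y)

theorem swapSign_comm (x y : ℤ) : swapSign x y = swapSign y x := by
  rw [swapSign, swapSign, mul_comm]

theorem chi_eq_prod {n : ℕ} (d : Fin n → ℤ) (σ : Equiv.Perm (Fin n)) :
    chi d σ = ∏ p : Fin n, ∏ q : Fin n,
      if p < q ∧ σ q < σ p then swapSign (d (σ p)) (d (σ q)) else 1 := by
  have hs : Equiv.Perm.sign σ =
      ∏ p : Fin n, ∏ q : Fin n, if p < q ∧ σ q < σ p then -1 else 1 := by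
    rw [Equiv.Perm.sign_eq_prod_prod_Iio, Finset.prod_comm]
    refine Finset.prod_congr rfl fun q _ => ?_
    rw [← Finset.prod_subset (Finset.subset_univ (Finset.Iio q))]
    · refine Finset.prod_congr rfl fun p hp => ?_
      have hp : p < q := Finset.mem_Iio.1 hp
      have hne : σ p ≠ σ q := fun h => hp.ne (σ.injective h)
      rcases lt_or_gt_of_ne hne with h | h
      · simp [h, h.not_gt]
      · simp [h, h.not_gt, hp]
    · intro p _ hp
      simp [show ¬ p < q from fun h => hp (Finset.mem_Iio.2 h)]
  rw [chi, koszulSign, hs, ← Finset.prod_mul_distrib]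
  refine Finset.prod_congr rfl fun p _ => ?_
  rw [← Finset.prod_mul_distrib]
  refine Finset.prod_congr rfl fun q _ => ?_
  split_ifs <;> simp [swapSign]

/-- For each pair of positions, an exchange by exactly one of the two permutations contributes the
same swap sign on both sides; a pair exchanged by both contributes a square, which is `1`. -/
theorem chi_mul {n : ℕ} (d : Fin n → ℤ) (σ τ : Equiv.Perm (Fin n)) :
    chi d (σ * τ) = chi d σ * chi (fun m => d (σ m)) τ := by
  have h1 : chi d σ = ∏ p : Fin n, ∏ q : Fin n,
      if τ p < τ q ∧ σ (τ q) < σ (τ p) then swapSign (d (σ (τ p))) (d (σ (τ q))) else 1 := by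
    rw [chi_eq_prod, ← Equiv.prod_comp τ]
    refine Finset.prod_congr rfl fun p _ => ?_
    rw [← Equiv.prod_comp τ]
  rw [h1, chi_eq_prod, chi_eq_prod, ← Finset.prod_mul_distrib]
  simp_rw [← Finset.prod_mul_distrib]
  refine prod_prod_congr_of_symm (fun p => by simp) fun p q hpq => ?_
  have hτ : τ p ≠ τ q := fun h => hpq.ne (τ.injective h)
  have hσ : σ (τ p) ≠ σ (τ q) := fun h => hτ (σ.injective h)
  rw [swapSign_comm (d (σ (τ q)))]
  simp only [Equiv.Perm.mul_apply, hpq, hpq.not_gt, true_and, false_and, if_false, mul_one]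
  generalize hw : swapSign (d (σ (τ p))) (d (σ (τ q))) = w
  have hww : w * w = 1 := Int.units_mul_self w
  rcases lt_or_gt_of_ne hτ with a | a <;> rcases lt_or_gt_of_ne hσ with b | b <;>
    simp [a, b, a.not_gt, b.not_gt, hww]

theorem chi_one {n : ℕ} (d : Fin n → ℤ) : chi d 1 = 1 := by
  have h := chi_mul d 1 1
  simpa using h

/-! ### Block permutations and their signs -/

section Blocks

variable {k s n : ℕ}

/-- `n = k + s` positions, split into a block of `s + 1` consecutive positions beginning at `r`
and the remaining `k - 1` positions. -/
def splitFun (h : k + s = n) (r : Fin k) : Fin (s + 1) ⊕ {P : Fin k // P ≠ r} → Fin n :=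
  Sum.elim (fun q => ⟨r + q, by omega⟩)
    (fun P => ⟨if (P : Fin k) < r then (P : Fin k) else (P : Fin k) + s, by split_ifs <;> omega⟩)

theorem splitFun_bijective (h : k + s = n) (r : Fin k) : Function.Bijective (splitFun h r) := by
  constructor
  · rintro (q | ⟨P, hP⟩) (q' | ⟨P', hP'⟩) he
    · simpa [splitFun, Fin.ext_iff] using he
    · have hP'' : (P' : ℕ) ≠ r := fun e => hP' (Fin.ext e)
      simp only [splitFun, Sum.elim_inl, Sum.elim_inr, Fin.ext_iff, Fin.lt_def] at he
      split_ifs at he <;> omega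
    · have hP'' : (P : ℕ) ≠ r := fun e => hP (Fin.ext e)
      simp only [splitFun, Sum.elim_inl, Sum.elim_inr, Fin.ext_iff, Fin.lt_def] at he
      split_ifs at he <;> omega
    · have h1 : (P : ℕ) ≠ r := fun e => hP (Fin.ext e)
      have h2 : (P' : ℕ) ≠ r := fun e => hP' (Fin.ext e)
      simp only [splitFun, Sum.elim_inr, Fin.ext_iff, Fin.lt_def] at he
      have : P = P' := Fin.ext (by split_ifs at he <;> omega)
      subst this
      rfl
  · intro p
    by_cases h1 : (p : ℕ) < r
    · refine ⟨Sum.inr ⟨⟨p, by omega⟩, fun e => ?_⟩, ?_⟩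
      · exact h1.ne (congrArg Fin.val e)
      · simp only [splitFun, Sum.elim_inr, Fin.lt_def, if_pos h1]
    · by_cases h2 : (p : ℕ) ≤ r + s
      · refine ⟨Sum.inl ⟨p - r, by omega⟩, Fin.ext ?_⟩
        simp only [splitFun, Sum.elim_inl]
        omega
      · refine ⟨Sum.inr ⟨⟨p - s, by omega⟩, fun e => ?_⟩, Fin.ext ?_⟩
        · simp only [← e] at h2
          omega
        · simp only [splitFun, Sum.elim_inr, Fin.lt_def]
          split_ifs <;> omega

/-- The equivalence underlying `splitFun`. -/
noncomputable def splitEquiv (h : k + s = n) (r : Fin k) :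
    Fin (s + 1) ⊕ {P : Fin k // P ≠ r} ≃ Fin n :=
  Equiv.ofBijective _ (splitFun_bijective h r)

theorem splitEquiv_inl (h : k + s = n) (r : Fin k) (q : Fin (s + 1)) :
    (splitEquiv h r (Sum.inl q) : ℕ) = r + q := rfl

theorem splitEquiv_inr (h : k + s = n) (r : Fin k) (P : {P : Fin k // P ≠ r}) :
    (splitEquiv h r (Sum.inr P) : ℕ) =
      if ((P : Fin k) : ℕ) < r then ((P : Fin k) : ℕ) else (P : Fin k) + s := rfl

/-- The permutation of `n = k + s` positions that carries the block beginning at `r` to the block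
beginning at `τ r`, permutes the block by `ρ`, and the remaining positions by `τ`. -/
noncomputable def blockPerm (h : k + s = n) (τ : Equiv.Perm (Fin k))
    (ρ : Equiv.Perm (Fin (s + 1))) (r : Fin k) : Equiv.Perm (Fin n) :=
  (splitEquiv h r).symm.trans
    ((Equiv.sumCongr ρ (τ.subtypeEquiv (p := fun P => P ≠ r) (q := fun P => P ≠ τ r)
      fun P => by simp)).trans (splitEquiv h (τ r)))

theorem blockPerm_inl (h : k + s = n) (τ : Equiv.Perm (Fin k)) (ρ : Equiv.Perm (Fin (s + 1)))
    (r : Fin k) (q : Fin (s + 1)) :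
    blockPerm h τ ρ r (splitEquiv h r (Sum.inl q)) = splitEquiv h (τ r) (Sum.inl (ρ q)) := by
  simp [blockPerm]

theorem blockPerm_inr (h : k + s = n) (τ : Equiv.Perm (Fin k)) (ρ : Equiv.Perm (Fin (s + 1)))
    (r : Fin k) (P : {P : Fin k // P ≠ r}) :
    blockPerm h τ ρ r (splitEquiv h r (Sum.inr P)) =
      splitEquiv h (τ r) (Sum.inr ⟨τ P, fun e => P.2 (τ.injective e)⟩) := by
  simp [blockPerm]

theorem blockPerm_inl_val (h : k + s = n) {τ : Equiv.Perm (Fin k)} (ρ : Equiv.Perm (Fin (s + 1)))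
    {r : Fin k} (hr : (τ r : ℕ) = 0) (q : Fin (s + 1)) :
    (blockPerm h τ ρ r (splitEquiv h r (Sum.inl q)) : ℕ) = ρ q := by
  rw [blockPerm_inl, splitEquiv_inl, hr, zero_add]

theorem blockPerm_inr_val (h : k + s = n) {τ : Equiv.Perm (Fin k)} (ρ : Equiv.Perm (Fin (s + 1)))
    {r : Fin k} (hr : (τ r : ℕ) = 0) (P : {P : Fin k // P ≠ r}) :
    (blockPerm h τ ρ r (splitEquiv h r (Sum.inr P)) : ℕ) = τ P + s := by
  rw [blockPerm_inr, splitEquiv_inr, hr]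
  simp

theorem prod_splitEquiv {M : Type*} [CommMonoid M] (h : k + s = n) (r : Fin k) (F : Fin n → M) :
    ∏ p, F p = (∏ q, F (splitEquiv h r (Sum.inl q))) * ∏ P, F (splitEquiv h r (Sum.inr P)) := by
  rw [← Equiv.prod_comp (splitEquiv h r), Fintype.prod_sum_type]

theorem prod_eq_mul_prod_ne {M : Type*} [CommMonoid M] (r : Fin k) (F : Fin k → M) :
    ∏ P, F P = F r * ∏ P : {P : Fin k // P ≠ r}, F P := by
  rw [← Finset.mul_prod_erase _ _ (Finset.mem_univ r)]
  congr 1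
  exact Finset.prod_subtype _ (by simp) _

/-- The degrees of the arguments of the outer operation of arity `k` when the inner operation
of arity `s + 1` is applied to the first `s + 1` arguments. -/
def outerDegree (h : k + s = n) (d : Fin n → ℤ) (P : Fin k) : ℤ :=
  if (P : ℕ) = 0 then (∑ q : Fin (s + 1), d ⟨q, by have := P.isLt; omega⟩) + ((s + 1 : ℕ) - 2)
  else d ⟨P + s, by omega⟩

theorem negOnePow_sum {ι : Type*} (t : Finset ι) (f : ι → ℤ) :
    Int.negOnePow (∑ i ∈ t, f i) = ∏ i ∈ t, Int.negOnePow (f i) := by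
  classical
  induction t using Finset.induction_on with
  | empty => simp
  | insert i t hi ih => rw [Finset.sum_insert hi, Finset.prod_insert hi, Int.negOnePow_add, ih]

/-- An element of degree `x` passes `s + 1` arguments one by one, or the output of an operation of
degree `s - 1` on them at once. The second way has `s` fewer minus signs and the extra factor
`(-1)^(x (s - 1))`. -/
theorem prod_swapSign (x : ℤ) (e : Fin (s + 1) → ℤ) :
    ∏ q, swapSign x (e q) =
      swapSign x ((∑ q, e q) + ((s + 1 : ℕ) - 2)) * Int.negOnePow ((s + 1) * x + s) := by
  have h1 : ∏ q, swapSign x (e q) =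
      Int.negOnePow (∑ q, (1 + x * e q)) := by
    rw [negOnePow_sum]
    refine Finset.prod_congr rfl fun q _ => ?_
    rw [swapSign, Int.negOnePow_add, Int.negOnePow_one, neg_one_mul]
  rw [h1, swapSign, Finset.sum_add_distrib, ← Finset.mul_sum,
    show ∀ y : ℤ, -Int.negOnePow y = Int.negOnePow (1 + y) from fun y => by
      rw [Int.negOnePow_add, Int.negOnePow_one, neg_one_mul], ← Int.negOnePow_add,
    Int.negOnePow_eq_iff]
  refine ⟨-(s : ℤ) * x, ?_⟩
  simp
  ring

/-- Inversions inside the block give `χ(ρ)`, and those among the other arguments also occur in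
`χ(τ)`. As the block moves to the front, it is crossed exactly by the `r` arguments preceding it,
each contributing the discrepancy of `prod_swapSign`. -/
theorem chi_blockPerm (h : k + s = n) (d : Fin n → ℤ) {τ : Equiv.Perm (Fin k)}
    (ρ : Equiv.Perm (Fin (s + 1))) {r : Fin k} (hr : (τ r : ℕ) = 0) :
    chi d (blockPerm h τ ρ r) =
      chi (fun q : Fin (s + 1) => d ⟨q, by omega⟩) ρ * chi (outerDegree h d) τ *
        Int.negOnePow ((s : ℤ) * r +
          ((s : ℤ) + 1) * ∑ m : Fin n, if (m : ℕ) < r then d (blockPerm h τ ρ r m) else 0) := by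
  have hne : ∀ P : {P : Fin k // P ≠ r}, ((P : Fin k) : ℕ) ≠ r := fun P e => P.2 (Fin.ext e)
  have hτ : ∀ P : {P : Fin k // P ≠ r}, (τ P : ℕ) ≠ 0 := fun P e =>
    P.2 (τ.injective (Fin.ext (e.trans hr.symm)))
  have hlast : Int.negOnePow ((s : ℤ) * r +
      ((s : ℤ) + 1) * ∑ m : Fin n, if (m : ℕ) < r then d (blockPerm h τ ρ r m) else 0) =
      ∏ P : {P : Fin k // P ≠ r}, if (P : Fin k) < r then
        Int.negOnePow (((s : ℤ) + 1) * outerDegree h d (τ P) + s) else 1 := by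
    -- Writing `r` as a count of preceding positions turns the correction into one factor per
    -- preceding argument.
    have hcard : ((r : ℕ) : ℤ) = ∑ m : Fin n, if (m : ℕ) < r then 1 else 0 := by
      rw [Finset.sum_boole, Fin.card_filter_val_lt]
      congr 1
      omega
    rw [hcard, Finset.mul_sum, Finset.mul_sum, ← Finset.sum_add_distrib, negOnePow_sum,
      prod_splitEquiv h r, Finset.prod_eq_one, one_mul]
    · refine Finset.prod_congr rfl fun P _ => ?_
      have hP := hne P
      rw [splitEquiv_inr]
      by_cases hlt : ((P : Fin k) : ℕ) < r
      · have e : blockPerm h τ ρ r (splitEquiv h r (Sum.inr P)) = ⟨τ P + s, by omega⟩ :=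
          Fin.ext (blockPerm_inr_val h ρ hr P)
        rw [if_pos hlt, if_pos hlt, if_pos hlt, if_pos (Fin.lt_def.2 hlt), e, outerDegree,
          if_neg (hτ P), mul_one, add_comm]
      · rw [if_neg hlt, if_neg (by omega), if_neg (by omega), if_neg (by rwa [Fin.lt_def])]
        simp
    · intro q _
      rw [splitEquiv_inl]
      simp
  have hb : ∀ q, blockPerm h τ ρ r (splitEquiv h r (Sum.inl q)) = ⟨ρ q, by omega⟩ := fun q =>
    Fin.ext (blockPerm_inl_val h ρ hr q)
  have hc : ∀ P, blockPerm h τ ρ r (splitEquiv h r (Sum.inr P)) = ⟨τ P + s, by omega⟩ := fun P =>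
    Fin.ext (blockPerm_inr_val h ρ hr P)
  have hL : chi d (blockPerm h τ ρ r) =
      chi (fun q : Fin (s + 1) => d ⟨q, by omega⟩) ρ *
      ((∏ P : {P : Fin k // P ≠ r}, if (P : Fin k) < r then
        ∏ q : Fin (s + 1), swapSign (outerDegree h d (τ P)) (d ⟨q, by omega⟩) else 1) *
      ∏ P : {P : Fin k // P ≠ r}, ∏ Q : {P : Fin k // P ≠ r},
        if (P : Fin k) < Q ∧ τ Q < τ P then
          swapSign (outerDegree h d (τ P)) (outerDegree h d (τ Q)) else 1) := by
    rw [chi_eq_prod, prod_splitEquiv h r]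
    simp_rw [prod_splitEquiv h r, Finset.prod_mul_distrib]
    rw [chi_eq_prod]
    have hB : ∏ q : Fin (s + 1), ∏ P : {P : Fin k // P ≠ r},
        (if splitEquiv h r (Sum.inl q) < splitEquiv h r (Sum.inr P) ∧
          blockPerm h τ ρ r (splitEquiv h r (Sum.inr P)) <
            blockPerm h τ ρ r (splitEquiv h r (Sum.inl q)) then
          swapSign (d (blockPerm h τ ρ r (splitEquiv h r (Sum.inl q))))
            (d (blockPerm h τ ρ r (splitEquiv h r (Sum.inr P)))) else 1) = 1 := by
      refine Finset.prod_eq_one fun q _ => Finset.prod_eq_one fun P _ => if_neg ?_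
      rintro ⟨-, hlt⟩
      rw [hb, hc, Fin.mk_lt_mk] at hlt
      have := hτ P
      omega
    rw [hB, mul_one]
    congr 1
    · refine Finset.prod_congr rfl fun q _ => Finset.prod_congr rfl fun q' _ => ?_
      rw [hb, hb]
      refine if_congr ?_ rfl rfl
      rw [Fin.lt_def, splitEquiv_inl, splitEquiv_inl, Fin.mk_lt_mk, Fin.lt_def, Fin.lt_def]
      omega
    congr 1
    · refine Finset.prod_congr rfl fun P _ => ?_
      have hP := hne P
      have hP' := hτ P
      rw [← Equiv.prod_comp ρ (fun q => swapSign (outerDegree h d (τ P)) (d ⟨q, by omega⟩))]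
      by_cases hlt : (P : Fin k) < r
      · rw [if_pos hlt]
        refine Finset.prod_congr rfl fun q _ => ?_
        rw [hb, hc, if_pos, outerDegree, if_neg hP']
        rw [Fin.lt_def, splitEquiv_inl, splitEquiv_inr, if_pos (Fin.lt_def.1 hlt), Fin.mk_lt_mk]
        rw [Fin.lt_def] at hlt
        omega
      · rw [if_neg hlt]
        refine Finset.prod_eq_one fun q _ => if_neg ?_
        rw [Fin.lt_def] at hlt
        rw [Fin.lt_def, splitEquiv_inl, splitEquiv_inr, if_neg hlt]
        omega
    · refine Finset.prod_congr rfl fun P _ => Finset.prod_congr rfl fun Q _ => ?_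
      rw [hc, hc, outerDegree, outerDegree, if_neg (hτ P), if_neg (hτ Q)]
      refine if_congr ?_ rfl rfl
      have hP := hne P
      have hQ := hne Q
      rw [Fin.lt_def, splitEquiv_inr, splitEquiv_inr, Fin.mk_lt_mk, Fin.lt_def, Fin.lt_def]
      split_ifs <;> omega
  have hR : chi (outerDegree h d) τ =
      (∏ P : {P : Fin k // P ≠ r}, if (P : Fin k) < r then
        swapSign (outerDegree h d (τ P)) (outerDegree h d (τ r)) else 1) *
      ∏ P : {P : Fin k // P ≠ r}, ∏ Q : {P : Fin k // P ≠ r},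
        if (P : Fin k) < Q ∧ τ Q < τ P then
          swapSign (outerDegree h d (τ P)) (outerDegree h d (τ Q)) else 1 := by
    rw [chi_eq_prod, prod_eq_mul_prod_ne r]
    simp_rw [prod_eq_mul_prod_ne r, Finset.prod_mul_distrib]
    have h0 : ∏ Q : {P : Fin k // P ≠ r}, (if r < (Q : Fin k) ∧ τ Q < τ r then
        swapSign (outerDegree h d (τ r)) (outerDegree h d (τ Q)) else 1) = 1 := by
      refine Finset.prod_eq_one fun Q _ => if_neg ?_
      rw [Fin.lt_def (a := τ _)]
      omega
    rw [if_neg (by simp), h0, one_mul, one_mul]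
    · congr 1
      refine Finset.prod_congr rfl fun P _ => if_congr ?_ rfl rfl
      have := hτ P
      rw [Fin.lt_def, Fin.lt_def]
      omega
  have hX : (∏ P : {P : Fin k // P ≠ r}, if (P : Fin k) < r then
        ∏ q : Fin (s + 1), swapSign (outerDegree h d (τ P)) (d ⟨q, by omega⟩) else 1) =
      (∏ P : {P : Fin k // P ≠ r}, if (P : Fin k) < r then
        swapSign (outerDegree h d (τ P)) (outerDegree h d (τ r)) else 1) *
      ∏ P : {P : Fin k // P ≠ r}, if (P : Fin k) < r then
        Int.negOnePow (((s : ℤ) + 1) * outerDegree h d (τ P) + s) else 1 := by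
    rw [← Finset.prod_mul_distrib]
    refine Finset.prod_congr rfl fun P _ => ?_
    split_ifs
    · rw [prod_swapSign]
      congr 2
      rw [outerDegree, if_pos hr]
    · rw [mul_one]
  rw [hL, hR, hlast, hX]
  ac_rfl

/-! ### Factoring a permutation through an unshuffle -/

theorem exists_blockPerm (h : k + s = n) (γ : Equiv.Perm (Fin n)) (r : Fin k)
    (hγ : ∀ q, (γ (splitEquiv h r (Sum.inl q)) : ℕ) < s + 1) :
    ∃ (τ : Equiv.Perm (Fin k)) (ρ : Equiv.Perm (Fin (s + 1))),
      (τ r : ℕ) = 0 ∧ blockPerm h τ ρ r = γ := by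
  have hinj : Function.Injective fun q => (⟨_, hγ q⟩ : Fin (s + 1)) := fun q q' e =>
    Sum.inl_injective ((splitEquiv h r).injective (γ.injective (Fin.ext (Fin.mk.inj e))))
  let ρ : Equiv.Perm (Fin (s + 1)) := Equiv.ofBijective _ (Finite.injective_iff_bijective.1 hinj)
  have hρ : ∀ q, (ρ q : ℕ) = γ (splitEquiv h r (Sum.inl q)) := fun q => rfl
  -- The block already fills the first `s + 1` places, since `ρ` is surjective.
  have hout : ∀ P, s + 1 ≤ (γ (splitEquiv h r (Sum.inr P)) : ℕ) := by
    intro P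
    by_contra! hlt
    obtain ⟨q, hq⟩ := ρ.surjective ⟨_, hlt⟩
    have h1 := γ.injective (Fin.ext ((hρ q).symm.trans (congrArg Fin.val hq)))
    exact Sum.inl_ne_inr ((splitEquiv h r).injective h1)
  -- The block collapses to the single place `0`; values at least `s + 1` shift down by `s` to
  -- values at least `1`.
  let t : Fin k → Fin k := fun P =>
    if e : P = r then ⟨0, r.pos⟩
    else ⟨γ (splitEquiv h r (Sum.inr ⟨P, e⟩)) - s, by have := hout ⟨P, e⟩; omega⟩
  have ht0 : (t r : ℕ) = 0 := by simp [t]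
  have ht : ∀ P : {P : Fin k // P ≠ r},
      (t P : ℕ) = γ (splitEquiv h r (Sum.inr P)) - s := fun P => by simp [t, P.2]
  have htinj : Function.Injective t := by
    intro P Q e
    have e := congrArg Fin.val e
    by_cases hP : P = r <;> by_cases hQ : Q = r
    · rw [hP, hQ]
    · have h1 : (t Q : ℕ) = _ := ht ⟨Q, hQ⟩
      have h2 := hout ⟨Q, hQ⟩
      rw [hP] at e
      omega
    · have h1 : (t P : ℕ) = _ := ht ⟨P, hP⟩
      have h2 := hout ⟨P, hP⟩
      rw [hQ] at e
      omega
    · have h1 : (t P : ℕ) = _ := ht ⟨P, hP⟩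
      have h2 := hout ⟨P, hP⟩
      have h3 : (t Q : ℕ) = _ := ht ⟨Q, hQ⟩
      have h4 := hout ⟨Q, hQ⟩
      have h5 := (splitEquiv h r).injective (γ.injective (Fin.ext
        (show (γ (splitEquiv h r (Sum.inr ⟨P, hP⟩)) : ℕ) =
          γ (splitEquiv h r (Sum.inr ⟨Q, hQ⟩)) by omega)))
      exact congrArg Subtype.val (Sum.inr_injective h5)
  refine ⟨Equiv.ofBijective t (Finite.injective_iff_bijective.1 htinj), ρ, ht0, ?_⟩
  ext p
  obtain ⟨q | P, rfl⟩ := (splitEquiv h r).surjective p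
  · rw [blockPerm_inl_val h ρ ht0, hρ]
  · rw [blockPerm_inr_val h ρ ht0, Equiv.ofBijective_apply, ht]
    have := hout P
    omega

/-- The unshuffle lists the image of the block under `π` in increasing order, then the complement in
increasing order. -/
theorem exists_isUnshuffle (h : k + s = n) (r : Fin k) (π : Equiv.Perm (Fin n)) :
    ∃ σ : Equiv.Perm (Fin n), IsUnshuffle (s + 1) σ ∧
      ∀ q, (σ.symm (π (splitEquiv h r (Sum.inl q))) : ℕ) < s + 1 := by
  let S : Finset (Fin n) := Finset.univ.map
    ⟨fun q => π (splitEquiv h r (Sum.inl q)), fun q q' e =>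
      Sum.inl_injective ((splitEquiv h r).injective (π.injective e))⟩
  have hS : S.card = s + 1 := by simp [S]
  have hSc : Sᶜ.card = k - 1 := by
    rw [Finset.card_compl, hS, Fintype.card_fin]
    omega
  have hr := r.pos
  let c : Fin (s + 1) ⊕ Fin (k - 1) ≃ Fin n :=
    finSumFinEquiv.trans (finCongr (by omega))
  have hcl : ∀ a, (c (Sum.inl a) : ℕ) = a := fun a => by simp [c]
  have hcr : ∀ a, (c (Sum.inr a) : ℕ) = s + 1 + a := fun a => by simp [c]
  refine ⟨c.symm.trans (finSumEquivOfFinset hS hSc), ?_, fun q => ?_⟩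
  · intro p p' hlt hcase
    obtain ⟨x, rfl⟩ := c.surjective p
    obtain ⟨y, rfl⟩ := c.surjective p'
    rw [Fin.lt_def] at hlt
    rcases x with x | x <;> rcases y with y | y
    · simp only [hcl] at hlt
      simpa using hlt
    · simp only [hcl, hcr] at hcase
      omega
    · simp only [hcl, hcr] at hlt
      omega
    · simp only [hcr] at hlt
      simpa using hlt
  · have hq : π (splitEquiv h r (Sum.inl q)) ∈ S :=
      Finset.mem_map_of_mem _ (Finset.mem_univ q)
    have : π (splitEquiv h r (Sum.inl q)) ∈ Set.range (S.orderEmbOfFin hS) := by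
      rw [Finset.range_orderEmbOfFin]
      exact hq
    obtain ⟨a, ha⟩ := this
    rw [← ha, ← finSumEquivOfFinset_inl hS hSc, Equiv.symm_trans_apply, Equiv.symm_apply_apply,
      Equiv.symm_symm, hcl]
    exact a.isLt

/-- An unshuffle is determined by the set of its first `i` values: if these agree, `σ⁻¹ σ'` is
strictly increasing on `Fin n`, hence the identity. -/
theorem IsUnshuffle.eq {i : ℕ} {σ σ' : Equiv.Perm (Fin n)} (hσ : IsUnshuffle i σ)
    (hσ' : IsUnshuffle i σ') (h : ∀ p, (σ.symm (σ' p) : ℕ) < i ↔ (p : ℕ) < i) : σ = σ' := by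
  have hmono : StrictMono fun p => σ.symm (σ' p) := by
    intro p q hpq
    have hpq' := Fin.lt_def.1 hpq
    have hp := h p
    have hq := h q
    by_cases hc : (q : ℕ) < i ∨ i ≤ (p : ℕ)
    · have h1 := hσ' p q hpq hc
      rcases lt_trichotomy (σ.symm (σ' p)) (σ.symm (σ' q)) with h2 | h2 | h2
      · exact h2
      · exact absurd (σ'.injective (σ.symm.injective h2)) hpq.ne
      · have h3 := hσ _ _ h2 (by omega)
        rw [Equiv.apply_symm_apply, Equiv.apply_symm_apply] at h3
        exact absurd h3 h1.not_gt
    · show σ.symm (σ' p) < σ.symm (σ' q)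
      rw [Fin.lt_def]
      omega
  have hid : (fun p => σ.symm (σ' p)) = id := (hmono.range_inj strictMono_id).1
    (by rw [Set.range_id]; exact (σ'.trans σ.symm).range_eq_univ)
  ext p
  rw [← σ.apply_symm_apply (σ' p)]
  exact congrArg (fun x => (σ x : ℕ)) (congrFun hid p).symm

/-- Given `(r, π)`, the set of arguments in the block determines `σ`, and then `σ⁻¹ π` determines
`τ` and `ρ`. The index set `S` is abstract so that no decidability instance is fixed. -/
theorem sum_isUnshuffle {M : Type*} [AddCommMonoid M] (h : k + s = n) (hk : 0 < k)
    (F : Fin k → Equiv.Perm (Fin n) → M) (S : Finset (Equiv.Perm (Fin n)))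
    (hS : ∀ σ, σ ∈ S ↔ IsUnshuffle (s + 1) σ) :
    ∑ σ ∈ S, ∑ τ : Equiv.Perm (Fin k), ∑ ρ : Equiv.Perm (Fin (s + 1)),
      F (τ.symm ⟨0, hk⟩) (σ * blockPerm h τ ρ (τ.symm ⟨0, hk⟩)) =
    ∑ r, ∑ π, F r π := by
  simp_rw [← Finset.sum_product']
  refine Finset.sum_bij (fun x _ => (x.2.1.symm ⟨0, hk⟩,
    x.1 * blockPerm h x.2.1 x.2.2 (x.2.1.symm ⟨0, hk⟩))) (by simp) ?_ ?_ (fun _ _ => rfl)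
  · rintro ⟨σ, τ, ρ⟩ hx ⟨σ', τ', ρ'⟩ hx' e
    simp only [Finset.mem_product, hS, Finset.mem_univ, and_true] at hx hx'
    obtain ⟨e1, e2⟩ := Prod.mk.inj e
    dsimp only at e1 e2
    rw [← e1] at e2
    obtain ⟨r, hr⟩ : ∃ r, r = τ.symm ⟨0, hk⟩ := ⟨_, rfl⟩
    rw [← hr] at e1 e2
    have h0 : (τ r : ℕ) = 0 := by simp [hr]
    have h0' : (τ' r : ℕ) = 0 := by simp [e1]
    have happ : ∀ p, σ (blockPerm h τ ρ r p) = σ' (blockPerm h τ' ρ' r p) := fun p =>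
      congrArg (fun f : Equiv.Perm (Fin n) => f p) e2
    have hσ : σ = σ' := by
      refine hx.eq hx' fun p => ?_
      obtain ⟨p, rfl⟩ := (blockPerm h τ' ρ' r).surjective p
      rw [← happ, Equiv.symm_apply_apply]
      obtain ⟨q | P, rfl⟩ := (splitEquiv h r).surjective p
      · rw [blockPerm_inl_val h ρ h0, blockPerm_inl_val h ρ' h0']
        exact iff_of_true (ρ q).isLt (ρ' q).isLt
      · rw [blockPerm_inr_val h ρ h0, blockPerm_inr_val h ρ' h0']
        have h1 : (τ P : ℕ) ≠ 0 := fun e => P.2 (τ.injective (Fin.ext (e.trans h0.symm)))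
        have h2 : (τ' P : ℕ) ≠ 0 := fun e => P.2 (τ'.injective (Fin.ext (e.trans h0'.symm)))
        omega
    subst hσ
    have happ' : ∀ p, (blockPerm h τ ρ r p : ℕ) = blockPerm h τ' ρ' r p := fun p =>
      congrArg Fin.val (σ.injective (happ p))
    have hρ : ρ = ρ' := by
      ext q
      have := happ' (splitEquiv h r (Sum.inl q))
      rwa [blockPerm_inl_val h ρ h0, blockPerm_inl_val h ρ' h0'] at this
    have hτ : τ = τ' := by
      ext P
      by_cases hP : P = r
      · rw [hP, h0, h0']
      · have := happ' (splitEquiv h r (Sum.inr ⟨P, hP⟩))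
        rw [blockPerm_inr_val h ρ h0, blockPerm_inr_val h ρ' h0'] at this
        exact Nat.add_right_cancel this
    rw [hρ, hτ]
  · rintro ⟨r, π⟩ -
    obtain ⟨σ, hσ, hπ⟩ := exists_isUnshuffle h r π
    obtain ⟨τ, ρ, h0, hγ⟩ := exists_blockPerm h (σ⁻¹ * π) r hπ
    have hr : τ.symm ⟨0, hk⟩ = r := by
      rw [Equiv.symm_apply_eq]
      exact (Fin.ext h0).symm
    refine ⟨⟨σ, τ, ρ⟩, by simp [hS, hσ], ?_⟩
    dsimp only
    rw [hr, hγ, mul_inv_cancel_left]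

end Blocks

/-! ### Prefactors, degree, skew-symmetry and compatibility with `α` -/

section Bracket

variable {K V : Type*} [Field K] [AddCommGroup V] [Module K V]
  {𝒜 : ℤ → Submodule K V} {μ : ∀ k : ℕ, MultilinearMap K (fun _ : Fin k => V) V}
  {α : V →ₗ[K] V} {k s n : ℕ}

theorem units_smul_mem (N : Submodule K V) (u : ℤˣ) {x : V} (hx : x ∈ N) : u • x ∈ N := by
  rw [Units.smul_def]
  exact zsmul_mem hx _

theorem pow_map_mem (hα : ∀ (i : ℤ) (x : V), x ∈ 𝒜 i → α x ∈ 𝒜 i) (s : ℕ) {i : ℤ} {x : V}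
    (hx : x ∈ 𝒜 i) : (α ^ s) x ∈ 𝒜 i := by
  induction s with
  | zero => simpa using hx
  | succ s ih =>
    rw [pow_succ', Module.End.mul_apply]
    exact hα i _ ih

/-- The prefactor `(-1)^((k-1)(k-2)/2)` of the bracket of arity `k`. -/
def bracketSign (k : ℕ) : ℤˣ := (-1) ^ ((k - 1) * (k - 2) / 2)

theorem bracketSign_succ (k : ℕ) : bracketSign (k + 1) = Int.negOnePow (k.choose 2) := by
  rw [bracketSign, Int.negOnePow_def, zpow_natCast, Nat.choose_two_right]
  congr 2

theorem choose_two_add (a b : ℕ) : (a + b).choose 2 = a.choose 2 + b.choose 2 + a * b := by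
  induction b with
  | zero => simp
  | succ b ih =>
    rw [← add_assoc, Nat.choose_succ_succ' (a + b) 1, Nat.choose_succ_succ' b 1, ih,
      Nat.choose_one_right, Nat.choose_one_right]
    ring

/-- With outer arity `a + 1` and inner arity `b + 1`, the cross term `a * b` of `choose_two_add`
matches the `HL∞` sign `(-1)^((b + 1) a)` up to `(-1)^a`. -/
theorem bracketSign_mul (a b : ℕ) :
    bracketSign (a + 1) * bracketSign (b + 1) * Int.negOnePow ((b + 1) * a) * Int.negOnePow b =
      bracketSign (a + b + 1) * Int.negOnePow (a + b) := by
  simp only [bracketSign_succ, choose_two_add, ← Int.negOnePow_add]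
  congr 1
  push_cast
  ring

variable [DirectSum.Decomposition 𝒜]

theorem bracket_apply (d : Fin k → ℤ) (a : Fin k → V) (ha : ∀ m, a m ∈ 𝒜 (d m)) :
    bracket 𝒜 μ k a =
      ((-1 : ℤ) ^ ((k - 1) * (k - 2) / 2)) •
        ∑ σ : Equiv.Perm (Fin k), chi d σ • μ k (fun m => a (σ m)) := by
  rw [← skewSymmetrization_apply 𝒜 μ k d a ha]
  rfl

theorem bracket_apply' (d : Fin k → ℤ) (a : Fin k → V) (ha : ∀ m, a m ∈ 𝒜 (d m)) :
    bracket 𝒜 μ k a =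
      bracketSign k • ∑ σ : Equiv.Perm (Fin k), chi d σ • μ k (fun m => a (σ m)) := by
  rw [bracket_apply d a ha, bracketSign, Units.smul_def]
  simp

theorem IsHAInfinity.bracket_mem (h : IsHAInfinity 𝒜 μ α) (hk : 1 ≤ k) (d : Fin k → ℤ)
    (a : Fin k → V) (ha : ∀ m, a m ∈ 𝒜 (d m)) :
    bracket 𝒜 μ k a ∈ 𝒜 ((∑ m, d m) + ((k : ℤ) - 2)) := by
  rw [bracket_apply' d a ha]
  refine units_smul_mem _ _ (Submodule.sum_mem _ fun σ _ => units_smul_mem _ _ ?_)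
  rw [← Equiv.sum_comp σ]
  exact h.degree_op k hk _ _ fun m => ha (σ m)

theorem bracket_comp_perm (d : Fin k → ℤ) (a : Fin k → V) (ha : ∀ m, a m ∈ 𝒜 (d m))
    (σ : Equiv.Perm (Fin k)) :
    bracket 𝒜 μ k (fun m => a (σ m)) = chi d σ • bracket 𝒜 μ k a := by
  rw [bracket_apply' d a ha, bracket_apply' (fun m => d (σ m)) _ fun m => ha (σ m), smul_comm]
  congr 1
  rw [Finset.smul_sum]
  conv_rhs => rw [← Equiv.sum_comp (Equiv.mulLeft σ)]
  refine Finset.sum_congr rfl fun τ _ => ?_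
  rw [Equiv.coe_mulLeft, chi_mul, smul_smul, ← mul_assoc, Int.units_mul_self, one_mul]
  rfl

/-- Lets `α` pass through the brackets on arbitrary, not only homogeneous, arguments. -/
theorem map_parityProj (hα : ∀ (i : ℤ) (x : V), x ∈ 𝒜 i → α x ∈ 𝒜 i) (e : Fin 2) (x : V) :
    α (parityProj 𝒜 e x) = parityProj 𝒜 e (α x) := by
  induction x using DirectSum.Decomposition.inductionOn 𝒜 with
  | zero => simp
  | @homogeneous i x =>
    rw [parityProj_apply 𝒜 e x.2, parityProj_apply 𝒜 e (hα i _ x.2)]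
    split_ifs <;> simp
  | add x y hx hy => simp only [map_add, hx, hy]

theorem IsHAInfinity.map_bracket (h : IsHAInfinity 𝒜 μ α) (hk : 1 ≤ k) (a : Fin k → V) :
    α (bracket 𝒜 μ k a) = bracket 𝒜 μ k (fun m => α (a m)) := by
  simp only [bracket, skewSymmetrization, smul_apply, sum_apply,
    MultilinearMap.compLinearMap_apply, MultilinearMap.domDomCongr_apply, map_zsmul, map_sum,
    h.map_op k hk, map_parityProj h.degree_map]

/-! ### The `HL∞`-relation as a skew-symmetrized `HA∞`-relation -/

/-- The arguments of the outer operation in a summand of `haRelation`. -/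
def haArgs (μ : ∀ k : ℕ, MultilinearMap K (fun _ : Fin k => V) V) (α : V →ₗ[K] V)
    (h : k + s = n) (r : Fin k) (a : Fin n → V) : Fin k → V := fun p =>
  if (p : ℕ) < r then (α ^ s) (a ⟨p, by omega⟩)
  else if (p : ℕ) = r then μ (s + 1) (fun q : Fin (s + 1) => a ⟨r + q, by omega⟩)
  else (α ^ s) (a ⟨p + s, by omega⟩)

/-- The arguments of the outer bracket in a summand of `hlRelation`. -/
def hlArgs (l : ∀ k : ℕ, MultilinearMap K (fun _ : Fin k => V) V) (α : V →ₗ[K] V)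
    (h : k + s = n) (a : Fin n → V) : Fin k → V := fun p =>
  if (p : ℕ) = 0 then l (s + 1) (fun q : Fin (s + 1) => a ⟨q, by have := p.isLt; omega⟩)
  else (α ^ s) (a ⟨p + s, by omega⟩)

theorem map_update_smul_sum {ι : Type*} (t : Finset ι) (f : MultilinearMap K (fun _ : Fin k => V) V)
    (c : Fin k → V) (r : Fin k) (u : ℤˣ) (v : ι → ℤˣ) (y : ι → V) :
    f (Function.update c r (u • ∑ i ∈ t, v i • y i)) =
      u • ∑ i ∈ t, v i • f (Function.update c r (y i)) := by
  simp only [Units.smul_def, ← MultilinearMap.toLinearMap_apply, map_sum, map_zsmul]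

/-- The family `l` is arbitrary because the only slot in which it enters is overwritten by the
update. -/
theorem haArgs_comp_blockPerm (h : k + s = n) {τ : Equiv.Perm (Fin k)}
    (ρ : Equiv.Perm (Fin (s + 1))) {r : Fin k} (hr : (τ r : ℕ) = 0) (a : Fin n → V)
    (l : ∀ k : ℕ, MultilinearMap K (fun _ : Fin k => V) V) :
    haArgs μ α h r (fun m => a (blockPerm h τ ρ r m)) =
      Function.update (fun P => hlArgs l α h a (τ P)) r
        (μ (s + 1) fun q => a ⟨ρ q, by omega⟩) := by
  funext P
  by_cases hP : P = r
  · subst hP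
    rw [Function.update_self, haArgs, if_neg (lt_irrefl _), if_pos rfl]
    congr 1
    funext q
    congr 1
    exact Fin.ext (blockPerm_inl_val h ρ hr q)
  · have hP' : (P : ℕ) ≠ r := fun e => hP (Fin.ext e)
    have h1 : (τ P : ℕ) ≠ 0 := fun e => hP (τ.injective (Fin.ext (e.trans hr.symm)))
    have h2 := blockPerm_inr_val h ρ hr ⟨P, hP⟩
    rw [Function.update_of_ne hP, haArgs, hlArgs, if_neg h1]
    by_cases hlt : (P : ℕ) < r
    · rw [if_pos hlt]
      congr 2
      refine Fin.ext (Eq.trans ?_ h2)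
      congr 2
      exact Fin.ext (by rw [splitEquiv_inr, if_pos hlt])
    · rw [if_neg hlt, if_neg hP']
      congr 2
      refine Fin.ext (Eq.trans ?_ h2)
      congr 2
      exact Fin.ext (by rw [splitEquiv_inr, if_neg hlt])

/-- The summand of `haRelation` with outer arity `k`, inner arity `s + 1` and inner position `r`. -/
def haTerm (μ : ∀ k : ℕ, MultilinearMap K (fun _ : Fin k => V) V) (α : V →ₗ[K] V)
    (h : k + s = n) (d : Fin n → ℤ) (a : Fin n → V) (r : Fin k) : V :=
  Int.negOnePow (((r : ℤ) + 1) * (((s : ℤ) + 1) + 1)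
    + ((s : ℤ) + 1) * ∑ m : Fin n, if (m : ℕ) < r then d m else 0) • μ k (haArgs μ α h r a)

theorem IsHAInfinity.bracket_hlArgs (hA : IsHAInfinity 𝒜 μ α) (h : k + s = n) (hk : 0 < k)
    (d : Fin n → ℤ) (a : Fin n → V) (ha : ∀ m, a m ∈ 𝒜 (d m)) :
    bracket 𝒜 μ k (hlArgs (bracket 𝒜 μ) α h a) =
      (bracketSign k * bracketSign (s + 1) * Int.negOnePow s) •
        ∑ τ : Equiv.Perm (Fin k), ∑ ρ : Equiv.Perm (Fin (s + 1)),
          chi d (blockPerm h τ ρ (τ.symm ⟨0, hk⟩)) •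
            haTerm μ α h (fun m => d (blockPerm h τ ρ (τ.symm ⟨0, hk⟩) m))
              (fun m => a (blockPerm h τ ρ (τ.symm ⟨0, hk⟩) m)) (τ.symm ⟨0, hk⟩) := by
  -- The explicit formula for the outer bracket requires homogeneous arguments, including the inner
  -- bracket.
  have hmem : ∀ P, hlArgs (bracket 𝒜 μ) α h a P ∈ 𝒜 (outerDegree h d P) := by
    intro P
    by_cases hP : (P : ℕ) = 0
    · rw [hlArgs, outerDegree, if_pos hP, if_pos hP]
      exact hA.bracket_mem (by omega) _ _ fun q => ha _
    · rw [hlArgs, outerDegree, if_neg hP, if_neg hP]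
      exact pow_map_mem hA.degree_map s (ha _)
  rw [bracket_apply' _ _ hmem, mul_assoc, mul_smul]
  congr 1
  rw [Finset.smul_sum]
  refine Finset.sum_congr rfl fun τ _ => ?_
  obtain ⟨r, hr⟩ : ∃ r, r = τ.symm ⟨0, hk⟩ := ⟨_, rfl⟩
  rw [← hr]
  have h0 : (τ r : ℕ) = 0 := by simp [hr]
  have hupd : (fun P => hlArgs (bracket 𝒜 μ) α h a (τ P)) =
      Function.update (fun P => hlArgs (bracket 𝒜 μ) α h a (τ P)) r
        (bracketSign (s + 1) • ∑ ρ : Equiv.Perm (Fin (s + 1)),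
          chi (fun q : Fin (s + 1) => d ⟨q, by omega⟩) ρ •
            μ (s + 1) fun q => a ⟨ρ q, by omega⟩) := by
    rw [eq_comm, Function.update_eq_self_iff, hlArgs, if_pos h0]
    exact (bracket_apply' (fun q : Fin (s + 1) => d ⟨q, by omega⟩) _ fun q => ha _).symm
  rw [hupd, map_update_smul_sum, mul_smul, smul_comm]
  congr 1
  rw [Finset.smul_sum, Finset.smul_sum]
  refine Finset.sum_congr rfl fun ρ _ => ?_
  rw [haTerm, haArgs_comp_blockPerm h ρ h0 a (bracket 𝒜 μ), smul_smul, smul_smul, smul_smul]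
  congr 1
  rw [chi_blockPerm h d ρ h0]
  generalize (∑ m : Fin n, if (m : ℕ) < r then d (blockPerm h τ ρ r m) else 0) = D
  -- The correction from `chi_blockPerm` and the `HA∞` sign agree up to `(-1)^s`.
  have hs : Int.negOnePow s * (Int.negOnePow ((s : ℤ) * r + ((s : ℤ) + 1) * D) *
      Int.negOnePow (((r : ℤ) + 1) * (((s : ℤ) + 1) + 1) + ((s : ℤ) + 1) * D)) = 1 := by
    rw [← Int.negOnePow_add, ← Int.negOnePow_add]
    refine Int.negOnePow_even _ ⟨s + s * r + r + 1 + (s + 1) * D, by ring⟩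
  rw [mul_assoc, mul_assoc (chi _ ρ * _), mul_left_comm, hs, mul_one, mul_comm]

theorem IsHAInfinity.hlRelation_bracket_eq (hA : IsHAInfinity 𝒜 μ α)
    (d : Fin n → ℤ) (a : Fin n → V) (ha : ∀ m, a m ∈ 𝒜 (d m)) :
    hlRelation (bracket 𝒜 μ) α d a =
      (bracketSign n * Int.negOnePow ((n : ℤ) - 1)) • ∑ π : Equiv.Perm (Fin n),
        chi d π • haRelation μ α (fun m => d (π m)) (fun m => a (π m)) := by
  classical
  have key : ∀ s : Fin n, ∀ S : Finset (Equiv.Perm (Fin n)),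
      (∀ σ, σ ∈ S ↔ IsUnshuffle ((s : ℕ) + 1) σ) →
      ∑ σ ∈ S, (chi d σ * Int.negOnePow (((s : ℤ) + 1) * (((n : ℤ) - (s : ℤ)) - 1))) •
        bracket 𝒜 μ (n - s) (hlArgs (bracket 𝒜 μ) α (Nat.sub_add_cancel s.isLt.le)
          fun m => a (σ m)) =
      (bracketSign n * Int.negOnePow ((n : ℤ) - 1)) • ∑ r : Fin (n - s),
        ∑ π : Equiv.Perm (Fin n), chi d π •
          haTerm μ α (Nat.sub_add_cancel s.isLt.le) (fun m => d (π m)) (fun m => a (π m)) r := by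
    intro s S hS
    have hk : 0 < n - (s : ℕ) := Nat.sub_pos_of_lt s.isLt
    rw [← sum_isUnshuffle (Nat.sub_add_cancel s.isLt.le) hk _ S hS, Finset.smul_sum]
    refine Finset.sum_congr rfl fun σ _ => ?_
    rw [hA.bracket_hlArgs _ hk (fun m => d (σ m)) _ fun m => ha (σ m), smul_smul]
    -- The total sign no longer depends on `s`, so it factors out of the whole relation.
    have hsign : Int.negOnePow (((s : ℤ) + 1) * (((n : ℤ) - (s : ℤ)) - 1)) *
        (bracketSign (n - s) * bracketSign (s + 1) * Int.negOnePow ((s : ℕ) : ℤ)) =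
        bracketSign n * Int.negOnePow ((n : ℤ) - 1) := by
      obtain ⟨b, hb⟩ : ∃ b, n - (s : ℕ) = b + 1 := ⟨n - s - 1, by omega⟩
      have hb' : n = b + s + 1 := by omega
      have hz : (n : ℤ) = b + (s : ℕ) + 1 := by exact_mod_cast hb'
      have := bracketSign_mul b s
      rw [← hb'] at this
      rw [hb, hz, show ((b : ℤ) + (s : ℕ) + 1 - (s : ℕ) - 1) = b by ring,
        show ((b : ℤ) + (s : ℕ) + 1 - 1) = b + (s : ℕ) by ring, ← this]
      ac_rfl
    rw [mul_assoc, hsign, mul_comm, mul_smul]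
    congr 1
    simp_rw [Finset.smul_sum, smul_smul, chi_mul]
    rfl
  rw [hlRelation]
  refine (Finset.sum_congr rfl fun s _ => key s _ fun σ => by simp).trans ?_
  rw [← Finset.smul_sum]
  congr 1
  simp_rw [haRelation, Finset.smul_sum]
  rw [Finset.sum_comm]
  refine Finset.sum_congr rfl fun s _ => ?_
  rw [Finset.sum_comm]
  rfl

theorem IsHAInfinity.isHLInfinity_bracket (h : IsHAInfinity 𝒜 μ α) :
    IsHLInfinity 𝒜 (bracket 𝒜 μ) α where
  degree_op _ hk d a ha := h.bracket_mem hk d a ha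
  skew_symm _ _ d a ha σ := bracket_comp_perm d a ha σ
  degree_map := h.degree_map
  map_op _ hk a := h.map_bracket hk a
  relation n hn d a ha := by
    rw [h.hlRelation_bracket_eq d a ha, Finset.sum_eq_zero, smul_zero]
    intro π _
    rw [h.relation n hn _ _ fun m => ha (π m), smul_zero]

/-! ### Brackets of low arity and vanishing -/

theorem sum_parityProj (x : V) : ∑ e, parityProj 𝒜 e x = x := by
  induction x using DirectSum.Decomposition.inductionOn 𝒜 with
  | zero => simp
  | @homogeneous i x =>
    rw [Fin.sum_univ_two, parityProj_apply 𝒜 0 x.2, parityProj_apply 𝒜 1 x.2]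
    rcases Int.emod_two_eq_zero_or_one i with h | h <;> simp [h]
  | add x y hx hy => simp only [map_add, Finset.sum_add_distrib, hx, hy]

theorem bracket_one : bracket 𝒜 μ 1 = μ 1 := by
  ext a
  simp only [bracket, skewSymmetrization, smul_apply, sum_apply,
    MultilinearMap.compLinearMap_apply, MultilinearMap.domDomCongr_apply,
    Fintype.sum_subsingleton _ (1 : Equiv.Perm (Fin 1)), chi_one]
  have h2 : ∀ e : Fin 1 → Fin 2, (fun m => parityProj 𝒜 (e m) (a m)) =
      Function.update a 0 (parityProj 𝒜 (e 0) (a 0)) := by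
    intro e
    funext m
    rw [Subsingleton.elim m 0, Function.update_self]
  -- The argument need not be homogeneous: linearity reassembles its even and odd parts.
  have h3 := (μ 1).map_update_sum Finset.univ 0 (fun e => parityProj 𝒜 e (a 0)) a
  rw [sum_parityProj, Function.update_eq_self] at h3
  rw [h3, ← Equiv.sum_comp (Equiv.funUnique (Fin 1) (Fin 2))]
  simp only [Equiv.Perm.one_apply, h2]
  simp

theorem bracket_two {i j : ℤ} {a b : V} (ha : a ∈ 𝒜 i) (hb : b ∈ 𝒜 j) :
    bracket 𝒜 μ 2 ![a, b] = μ 2 ![a, b] - Int.negOnePow (i * j) • μ 2 ![b, a] := by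
  rw [bracket_apply' ![i, j] ![a, b] (by simp [Fin.forall_fin_two, ha, hb])]
  have hu : (Finset.univ : Finset (Equiv.Perm (Fin 2))) = {1, Equiv.swap 0 1} := by decide
  have h1 : (fun m => ![a, b] ((1 : Equiv.Perm (Fin 2)) m)) = ![a, b] := rfl
  have h2 : (fun m => ![a, b] (Equiv.swap (0 : Fin 2) 1 m)) = ![b, a] := by
    funext m
    fin_cases m <;> simp
  have h3 : chi ![i, j] (Equiv.swap (0 : Fin 2) 1) = -Int.negOnePow (i * j) := by
    rw [chi_eq_prod]
    simp [Fin.prod_univ_two, swapSign, mul_comm]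
  rw [hu, Finset.sum_pair (by decide), h1, h2, h3, chi_one, one_smul]
  simp [bracketSign, Units.neg_smul, sub_eq_add_neg]

theorem bracket_eq_zero (h : μ k = 0) : bracket 𝒜 μ k = 0 := by
  ext a
  simp [bracket, skewSymmetrization, h]

end Bracket

end HomAlg

theorem mainTheorem12 {K V : Type*} [Field K] [CharZero K] [AddCommGroup V] [Module K V]
    (𝒜 : ℤ → Submodule K V) [DirectSum.Decomposition 𝒜]
    (μ : ∀ k : ℕ, MultilinearMap K (fun _ : Fin k => V) V) (α : V →ₗ[K] V)
    (h : HomAlg.IsHAInfinity 𝒜 μ α) :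
    -- the maps `l_k` are the skew-symmetrizations, given by this formula on homogeneous elements
    (∀ k : ℕ, 1 ≤ k → ∀ (d : Fin k → ℤ) (a : Fin k → V), (∀ m, a m ∈ 𝒜 (d m)) →
      HomAlg.bracket 𝒜 μ k a =
        ((-1 : ℤ) ^ ((k - 1) * (k - 2) / 2)) •
          ∑ σ : Equiv.Perm (Fin k), HomAlg.chi d σ • μ k (fun m => a (σ m))) ∧
    -- they form an `HL∞`-algebra together with `α`
    HomAlg.IsHLInfinity 𝒜 (HomAlg.bracket 𝒜 μ) α ∧
    -- `l_1 = μ_1`, `l_2` is the graded commutator of `μ_2`, and `l_k = 0` whenever `μ_k = 0`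
    HomAlg.bracket 𝒜 μ 1 = μ 1 ∧
    (∀ (i j : ℤ) (a b : V), a ∈ 𝒜 i → b ∈ 𝒜 j →
      HomAlg.bracket 𝒜 μ 2 ![a, b] =
        μ 2 ![a, b] - Int.negOnePow (i * j) • μ 2 ![b, a]) ∧
    (∀ k : ℕ, 1 ≤ k → μ k = 0 → HomAlg.bracket 𝒜 μ k = 0) :=
  ⟨fun _ _ d a ha => HomAlg.bracket_apply d a ha, h.isHLInfinity_bracket, HomAlg.bracket_one,
    fun _ _ _ _ ha hb => HomAlg.bracket_two ha hb, fun _ _ hk => HomAlg.bracket_eq_zero hk⟩
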